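/- Let $X_1,X_2$ be diffeological spaces, let $Y\subseteq X_1$, and let $f:Y\to X_2$ be a diffeomorphism of $Y$ onto its image $f(Y)\subseteq X_2$ ($Y$ and $f(Y)$ carry the subset diffeologies). Let $X=X_1\cup_f X_2$ be the quotient of $X_1\sqcup X_2$ by the equivalence relation generated by $y\sim f(y)$, $y\in Y$, with the quotient diffeology of the disjoint union diffeology, and let $\tilde i_1:X_1\to X$ and $i_2:X_2\to X$ be the natural maps (both are injective) and $i_1=\tilde i_1|_{X_1\setminus Y}$; thus $X$ is the disjoint union of $i_1(X_1\setminus Y)$, $i_2(f(Y))$ and $i_2(X_2\setminus f(Y))$, and $\tilde i_1(y)=i_2(f(y))$ for $y\in Y$. For a diffeological space $Z$ let $\Omega^1(Z)$ be the vector space of differential $1$-forms on $Z$, with its functional diffeology (a map $q:U'\to\Omega^1(Z)$ is a plot iff $(u',u)\mapsto q(u')(p)(u)$ is smooth for every plot $p$ of $Z$). For $z\in Z$ let $\Omega^1_z(Z)$ be the subspace of the forms $\omega$ with $\omega(p)(0)=0$ for every plot $p$ with $p(0)=z$, and let $\Lambda^1(Z)$ be the pseudo-bundle over $Z$ with fibres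 $\Lambda^1_z(Z)=\Omega^1(Z)/\Omega^1_z(Z)$. For a smooth function $h:Z\to\mathbb R$, the form $dh\in\Omega^1(Z)$ is given by $(dh)(p)=d(h\circ p)$, and the section $dh$ of $\Lambda^1(Z)$ by $dh(z)=dh+\Omega^1_z(Z)$. Let $i:Y\to X_1$ and $j:f(Y)\to X_2$ be the inclusions. Assume that $\mathcal D_1^\Omega=\mathcal D_2^\Omega$, where $\mathcal D_1^\Omega$ and $\mathcal D_2^\Omega$ are the diffeologies on $\Omega^1(Y)$ obtained as the pushforwards of the diffeologies of $\Omega^1(X_1)$ by $i^*$ and of $\Omega^1(X_2)$ by $f^*j^*$ respectively. The pullbacks $\tilde i_1^*$ and $i_2^*$ induce fibrewise linear maps $\tilde\rho_1^\Lambda:\Lambda^1_{\tilde i_1(x_1)}(X)\to\Lambda^1_{x_1}(X_1)$ ($x_1\in X_1$) and $\tilde\rho_2^\Lambda:\Lambda^1_{i_2(x_2)}(X)\to\Lambda^1_{x_2}(X_2)$ ($x_2\in X_2$). Forms $\omega_1\in\Omega^1(X_1)$, $\omega_2\in\Omega^1(X_2)$ are compatible if $\omega_1(p)=\omega_2(f\circ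 p)$ for every plot $p$ of $X_1$ with values in $Y$. For $y\in Y$, let $\Lambda^1_y(X_1)\oplus_{comp}\Lambda^1_{f(y)}(X_2)\subseteq\Lambda^1_y(X_1)\oplus\Lambda^1_{f(y)}(X_2)$ be the subspace of the pairs of classes that are represented by a pair of compatible forms. Let $h_1:X_1\to\mathbb R$ and $h_2:X_2\to\mathbb R$ be smooth functions with $h_1(y)=h_2(f(y))$ for all $y\in Y$, and let $h=h_1\cup_f h_2:X\to\mathbb R$ be the smooth function with $h\circ\tilde i_1=h_1$ and $h\circ i_2=h_2$. Then: (1) if $x\in i_1(X_1\setminus Y)$ and $x_1=i_1^{-1}(x)$, then $\tilde\rho_1^\Lambda:\Lambda^1_x(X)\to\Lambda^1_{x_1}(X_1)$ is bijective and $dh(x)=(\tilde\rho_1^\Lambda)^{-1}(dh_1(x_1))$; (2) if $x\in i_2(f(Y))$ and $y=\tilde i_1^{-1}(x)$, so that $f(y)=i_2^{-1}(x)$, then $\tilde\rho_1^\Lambda\oplus\tilde\rho_2^\Lambda:\Lambda^1_x(X)\to\Lambda^1_y(X_1)\oplus_{comp}\Lambda^1_{f(y)}(X_2)$ is bijective,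 $dh_1(y)\oplus dh_2(f(y))$ belongs to its target, and $dh(x)=(\tilde\rho_1^\Lambda\oplus\tilde\rho_2^\Lambda)^{-1}(dh_1(y)\oplus dh_2(f(y)))$; (3) if $x\in i_2(X_2\setminus f(Y))$ and $x_2=i_2^{-1}(x)$, then $\tilde\rho_2^\Lambda:\Lambda^1_x(X)\to\Lambda^1_{x_2}(X_2)$ is bijective and $dh(x)=(\tilde\rho_2^\Lambda)^{-1}(dh_2(x_2))$. -/

import Mathlib

open Diffeology
open scoped ContDiff

noncomputable section

namespace DiffGlue

/-- The coordinate space `ℝⁿ`, the domain of the plots. -/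
abbrev E (n : ℕ) : Type := EuclideanSpace ℝ (Fin n)

/-! ### Constructions of diffeologies -/

/-- The subset diffeology: its plots are the plots of `X` with values in `s`. -/
instance subsetDiffeology {X : Type*} [DiffeologicalSpace X] (s : Set X) :
    DiffeologicalSpace s where
  plots n := {p | IsPlot (fun u : E n => (p u : X))}
  constant_plots x := isPlot_const (x := (x : X))
  plot_reparam hp hf := isPlot_reparam hp hf
  locality {n p} h := by
    refine DiffeologicalSpace.locality (p := fun u : E n => (p u : X)) fun x => ?_
    obtain ⟨u, hu, hx, h'⟩ := h x
    exact ⟨u, hu, hx, fun hfu hf => h' hfu hf⟩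

/-- The pushforward diffeology: the smallest diffeology on `B` for which `g` is smooth. -/
@[reducible]
def pushforward {A B : Type*} [DiffeologicalSpace A] (g : A → B) : DiffeologicalSpace B :=
  sInf {d | @DSmooth A B _ d g}

/-- The disjoint union diffeology: the smallest one for which both injections are smooth. -/
instance sumDiffeology {A B : Type*} [DiffeologicalSpace A] [DiffeologicalSpace B] :
    DiffeologicalSpace (A ⊕ B) :=
  sInf {d | @DSmooth A (A ⊕ B) _ d Sum.inl ∧ @DSmooth B (A ⊕ B) _ d Sum.inr}

theorem dSmooth_pushforward {A B : Type*} [DiffeologicalSpace A] (g : A → B) :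
    @DSmooth A B _ (pushforward g) g := fun n p hp =>
  DiffeologicalSpace.isPlot_sInf_iff.2 fun _ hd => hd n p hp

theorem dSmooth_of_pushforward {A B C : Type*} [DiffeologicalSpace A] [dC : DiffeologicalSpace C]
    (g : A → B) (k : B → C) (hk : DSmooth (k ∘ g)) :
    @DSmooth B C (pushforward g) dC k := by
  -- the diffeology on `B` whose plots are the maps with smooth composite with `k`
  let d : DiffeologicalSpace B :=
    { plots := fun n => {p : E n → B | IsPlot (k ∘ p)}
      constant_plots := fun x => isPlot_const (x := k x)
      plot_reparam := fun hp hf => isPlot_reparam hp hf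
      locality := fun {n p} h => by
        refine DiffeologicalSpace.locality (p := k ∘ p) fun x => ?_
        obtain ⟨u, hu, hx, h'⟩ := h x
        exact ⟨u, hu, hx, fun hfu hf => h' hfu hf⟩ }
  intro n p hp
  exact DiffeologicalSpace.isPlot_sInf_iff.1 hp d (fun m q hq => hk m q hq)

theorem dSmooth_inl {A B : Type*} [DiffeologicalSpace A] [DiffeologicalSpace B] :
    DSmooth (Sum.inl : A → A ⊕ B) := fun n p hp =>
  DiffeologicalSpace.isPlot_sInf_iff.2 fun _ hd => hd.1 n p hp

theorem dSmooth_inr {A B : Type*} [DiffeologicalSpace A] [DiffeologicalSpace B] :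
    DSmooth (Sum.inr : B → A ⊕ B) := fun n p hp =>
  DiffeologicalSpace.isPlot_sInf_iff.2 fun _ hd => hd.2 n p hp

theorem dSmooth_sumElim {A B C : Type*} [DiffeologicalSpace A] [DiffeologicalSpace B]
    [DiffeologicalSpace C] {a : A → C} {b : B → C} (ha : DSmooth a) (hb : DSmooth b) :
    DSmooth (Sum.elim a b) := by
  let d : DiffeologicalSpace (A ⊕ B) :=
    { plots := fun n => {p : E n → A ⊕ B | IsPlot (Sum.elim a b ∘ p)}
      constant_plots := fun x => isPlot_const (x := Sum.elim a b x)
      plot_reparam := fun hp hf => isPlot_reparam hp hf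
      locality := fun {n p} h => by
        refine DiffeologicalSpace.locality (p := Sum.elim a b ∘ p) fun x => ?_
        obtain ⟨u, hu, hx, h'⟩ := h x
        exact ⟨u, hu, hx, fun hfu hf => h' hfu hf⟩ }
  intro n p hp
  exact DiffeologicalSpace.isPlot_sInf_iff.1 hp d
    ⟨fun m q hq => ha m q hq, fun m q hq => hb m q hq⟩

theorem dSmooth_val {X : Type*} [DiffeologicalSpace X] (s : Set X) :
    DSmooth (Subtype.val : s → X) := fun _ _ hp => hp

/-- Diffeomorphisms: smooth maps with a smooth two-sided inverse. -/
def IsDiffeomorphism {A B : Type*} [DiffeologicalSpace A] [DiffeologicalSpace B]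
    (g : A → B) : Prop :=
  DSmooth g ∧ ∃ k : B → A, DSmooth k ∧ Function.LeftInverse k g ∧ Function.RightInverse k g

/-! ### Differential `1`-forms and the pseudo-bundle `Λ¹` -/

/-- Families that assign a (not necessarily smooth) `1`-form on `ℝⁿ` to every plot
`p : ℝⁿ → X`. -/
def PreForm (X : Type*) [DiffeologicalSpace X] : Type _ :=
  ∀ n : ℕ, {p : E n → X // IsPlot p} → E n → (E n →L[ℝ] ℝ)

instance (X : Type*) [DiffeologicalSpace X] : AddCommGroup (PreForm X) :=
  inferInstanceAs (AddCommGroup (∀ n : ℕ, {p : E n → X // IsPlot p} → E n → (E n →L[ℝ] ℝ)))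

instance (X : Type*) [DiffeologicalSpace X] : Module ℝ (PreForm X) :=
  inferInstanceAs (Module ℝ (∀ n : ℕ, {p : E n → X // IsPlot p} → E n → (E n →L[ℝ] ℝ)))

/-- The space `Ω¹(X)` of differential `1`-forms: a smooth `1`-form on `ℝⁿ` for every plot
`p : ℝⁿ → X`, compatible with smooth changes of parameter. -/
def Omega (X : Type*) [DiffeologicalSpace X] :
    Submodule ℝ (PreForm X) where
  carrier := {η | (∀ n p, ContDiff ℝ ∞ (η n p)) ∧
    ∀ (m n : ℕ) (p : {p : E n → X // IsPlot p}) (F : E m → E n) (hF : ContDiff ℝ ∞ F) (u : E m),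
      η m ⟨p.1 ∘ F, isPlot_reparam p.2 hF⟩ u = (η n p (F u)).comp (fderiv ℝ F u)}
  zero_mem' := ⟨fun _ _ => contDiff_const (c := 0),
    fun _ _ _ _ _ _ => (ContinuousLinearMap.zero_comp _).symm⟩
  add_mem' {a b} ha hb := ⟨fun n p => (ha.1 n p).add (hb.1 n p), fun m n p F hF u => by
    change a m _ u + b m _ u = (a n p (F u) + b n p (F u)).comp _
    rw [ha.2 m n p F hF u, hb.2 m n p F hF u, ContinuousLinearMap.add_comp]⟩
  smul_mem' c a ha := ⟨fun n p => (ha.1 n p).const_smul c, fun m n p F hF u => by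
    change c • a m _ u = (c • a n p (F u)).comp _
    rw [ha.2 m n p F hF u, ContinuousLinearMap.smul_comp]⟩

theorem mem_Omega {X : Type*} [DiffeologicalSpace X] {η : PreForm X} :
    η ∈ Omega X ↔ (∀ n p, ContDiff ℝ ∞ (η n p)) ∧
      ∀ (m n : ℕ) (p : {p : E n → X // IsPlot p}) (F : E m → E n) (hF : ContDiff ℝ ∞ F) (u : E m),
        η m ⟨p.1 ∘ F, isPlot_reparam p.2 hF⟩ u = (η n p (F u)).comp (fderiv ℝ F u) :=
  Iff.rfl

/-- The functional diffeology of `Ω¹(X)`: a map `q` into `Ω¹(X)` is a plot when, for every plot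
`p` of `X`, the map `(u', u) ↦ q(u')(p)(u)` is smooth. -/
instance omegaDiffeology (X : Type*) [DiffeologicalSpace X] : DiffeologicalSpace (Omega X) :=
  DiffeologicalSpace.ofCorePlotsOn
    { isPlotOn := fun {m s} _ q => ∀ (n : ℕ) (p : {p : E n → X // IsPlot p}),
        ContDiffOn ℝ ∞ (fun z : E m × E n => (q z.1).1 n p z.2) (s ×ˢ Set.univ)
      isPlotOn_congr := fun {_ _} _ {_ _} h => forall₂_congr fun _ _ =>
        contDiffOn_congr fun z hz => by rw [h hz.1]
      isPlot := fun {m} q => ∀ (n : ℕ) (p : {p : E n → X // IsPlot p}),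
        ContDiff ℝ ∞ (fun z : E m × E n => (q z.1).1 n p z.2)
      isPlotOn_univ := by simp [contDiffOn_univ]
      isPlot_const := fun η n p => ((mem_Omega.1 η.2).1 n p).comp contDiff_snd
      isPlotOn_reparam := fun {m k s t} hs ht {q F} hF hq hFs n p => by
        refine (hq n p).comp (f := fun z : E k × E n => (F z.1, z.2)) ?_ ?_
        · exact (hFs.comp contDiff_fst.contDiffOn fun z hz => hz.1).prodMk contDiff_snd.contDiffOn
        · exact fun z hz => ⟨hF hz.1, trivial⟩
      locality := fun {m s} hs {q} h n p z hz => by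
        obtain ⟨v, hv, hzv, hq⟩ := h z.1 hz.1
        exact ((hq n p).contDiffAt
          ((hv.prod isOpen_univ).mem_nhds ⟨hzv, trivial⟩)).contDiffWithinAt }

/-- The pullback `g^* : Ω¹(B) → Ω¹(A)` along a smooth map `g`, `(g^* ω)(p) = ω(g ∘ p)`. -/
def pullback {A B : Type*} [DiffeologicalSpace A] [DiffeologicalSpace B] (g : A → B)
    (hg : DSmooth g) : Omega B →ₗ[ℝ] Omega A where
  toFun η := ⟨fun n p => η.1 n ⟨g ∘ p.1, hg n p.1 p.2⟩,
    mem_Omega.2 ⟨fun _ _ => (mem_Omega.1 η.2).1 _ _,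
      fun m n p F hF u => (mem_Omega.1 η.2).2 m n ⟨g ∘ p.1, hg n p.1 p.2⟩ F hF u⟩⟩
  map_add' _ _ := rfl
  map_smul' _ _ := rfl

/-- The subspace `Ω¹_x(X)` of forms vanishing at `x`: those with `ω(p)(0) = 0` for every plot `p`
centered at `x`. -/
def vanishing {X : Type*} [DiffeologicalSpace X] (x : X) : Submodule ℝ (Omega X) where
  carrier := {η | ∀ (n : ℕ) (p : {p : E n → X // IsPlot p}), p.1 0 = x → η.1 n p 0 = 0}
  zero_mem' := fun _ _ _ => rfl
  add_mem' {a b} ha hb n p hp := by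
    change a.1 n p 0 + b.1 n p 0 = 0
    rw [ha n p hp, hb n p hp, add_zero]
  smul_mem' c a ha n p hp := by
    change c • a.1 n p 0 = 0
    rw [ha n p hp, smul_zero]

/-- The fibre `Λ¹_x(X) = Ω¹(X) / Ω¹_x(X)` of the pseudo-bundle `Λ¹(X)` over `x`. -/
abbrev LambdaFibre (X : Type*) [DiffeologicalSpace X] (x : X) : Type _ :=
  Omega X ⧸ vanishing x

/-- The differential `dh ∈ Ω¹(X)` of a smooth function, `(dh)(p) = d(h ∘ p)`. -/
def dForm {X : Type*} [DiffeologicalSpace X] (h : X → ℝ) (hh : DSmooth h) : Omega X :=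
  ⟨fun n p => fderiv ℝ (h ∘ p.1), by
    have hs : ∀ (n : ℕ) (p : {p : E n → X // IsPlot p}), ContDiff ℝ ∞ (h ∘ p.1) :=
      fun n p => (hh n p.1 p.2).contDiff
    refine mem_Omega.2 ⟨fun n p => (hs n p).fderiv_right (m := ∞) (by simp), fun m n p F hF u => ?_⟩
    exact fderiv_comp u ((hs n p).differentiable (by simp) (F u))
      (hF.differentiable (by simp) u)⟩

/-- The differential as a section of `Λ¹(X)`: the class of `(x, dh)` in the fibre over `x`. -/
def dSection {X : Type*} [DiffeologicalSpace X] (h : X → ℝ) (hh : DSmooth h) (x : X) :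
    LambdaFibre X x :=
  (vanishing x).mkQ (dForm h hh)

/-- The linear map `Λ¹_b(B) → Λ¹_a(A)`, `b = g(a)`, induced by the pullback `g^*`. -/
def fibrePullback {A B : Type*} [DiffeologicalSpace A] [DiffeologicalSpace B] (g : A → B)
    (hg : DSmooth g) (a : A) (b : B) (hab : g a = b) : LambdaFibre B b →ₗ[ℝ] LambdaFibre A a :=
  (vanishing b).mapQ (vanishing a) (pullback g hg) fun _ hη n p hp =>
    hη n ⟨g ∘ p.1, hg n p.1 p.2⟩ (by simp [hp, hab])

/-! ### Gluing -/

section Gluing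

variable {X₁ X₂ : Type*} {Y : Set X₁} (f : Y → X₂)

/-- The relation on `X₁ ⊔ X₂` that relates `y ∈ Y` to `f(y)`. -/
inductive GlueRel : X₁ ⊕ X₂ → X₁ ⊕ X₂ → Prop
  | glue (y : Y) : GlueRel (Sum.inl (y : X₁)) (Sum.inr (f y))

/-- The glued space `X₁ ∪_f X₂`: the quotient of `X₁ ⊔ X₂` by the equivalence relation generated
by `y ∼ f(y)`. -/
def Glue : Type _ := Quot (GlueRel f)

/-- The map `ĩ₁ : X₁ → X₁ ∪_f X₂`; its restriction to `X₁ ∖ Y` is `i₁`. -/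
def i₁ (x : X₁) : Glue f := Quot.mk _ (Sum.inl x)

/-- The map `i₂ : X₂ → X₁ ∪_f X₂`. -/
def i₂ (x : X₂) : Glue f := Quot.mk _ (Sum.inr x)

theorem i₁_eq_i₂ (y : Y) : i₁ f y = i₂ f (f y) := Quot.sound (GlueRel.glue y)

open Classical in
/-- An auxiliary normal form for the points of `X₁ ∪_f X₂`. -/
def normalForm : Glue f → X₁ ⊕ X₂ :=
  Quot.lift (Sum.elim (fun x => if hx : x ∈ Y then Sum.inr (f ⟨x, hx⟩) else Sum.inl x) Sum.inr)
    (by rintro _ _ ⟨y⟩; simp)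

/-- The points of `i₁(X₁ ∖ Y)`, `i₂(f(Y))` and `i₂(X₂ ∖ f(Y))` exhaust the glued space. -/
theorem exists_rep (x : Glue f) :
    (∃ x₁, x₁ ∉ Y ∧ i₁ f x₁ = x) ∨ (∃ y : Y, i₂ f (f y) = x) ∨
      ∃ x₂, x₂ ∉ Set.range f ∧ i₂ f x₂ = x := by
  obtain ⟨z, rfl⟩ := Quot.exists_rep x
  rcases z with x₁ | x₂
  · by_cases hx : x₁ ∈ Y
    · exact Or.inr (Or.inl ⟨⟨x₁, hx⟩, (i₁_eq_i₂ f ⟨x₁, hx⟩).symm⟩)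
    · exact Or.inl ⟨x₁, hx, rfl⟩
  · by_cases hx : x₂ ∈ Set.range f
    · obtain ⟨y, rfl⟩ := hx
      exact Or.inr (Or.inl ⟨y, rfl⟩)
    · exact Or.inr (Or.inr ⟨x₂, hx, rfl⟩)

theorem i₂_injective : Function.Injective (i₂ f) := fun a b h => by
  simpa [normalForm, i₂] using congrArg (normalForm f) h

theorem i₁_injective (hf : Function.Injective f) : Function.Injective (i₁ f) := fun a b h => by
  have h' := congrArg (normalForm f) h
  by_cases ha : a ∈ Y <;> by_cases hb : b ∈ Y <;> simp [normalForm, i₁, ha, hb] at h'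
  · exact congrArg Subtype.val (hf h')
  · exact h'

/-- The images `i₁(X₁ ∖ Y)` and `i₂(X₂)` are disjoint. -/
theorem i₁_ne_i₂ {x₁ : X₁} (h₁ : x₁ ∉ Y) (x₂ : X₂) : i₁ f x₁ ≠ i₂ f x₂ := fun h => by
  simpa [normalForm, i₁, i₂, h₁] using congrArg (normalForm f) h

/-- The glued map `h₁ ∪_f h₂` of two maps compatible with `f`. -/
def glueMap {C : Type*} (h₁ : X₁ → C) (h₂ : X₂ → C) (hc : ∀ y : Y, h₁ y = h₂ (f y)) :
    Glue f → C :=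
  Quot.lift (Sum.elim h₁ h₂) (by rintro _ _ ⟨y⟩; exact hc y)

variable [DiffeologicalSpace X₁] [DiffeologicalSpace X₂]

/-- The gluing diffeology: the quotient of the disjoint union diffeology. -/
instance glueDiffeology : DiffeologicalSpace (Glue f) :=
  pushforward (Quot.mk (GlueRel f) : X₁ ⊕ X₂ → Glue f)

theorem dSmooth_i₁ : DSmooth (i₁ f) :=
  DSmooth.comp (Z := Glue f) (dSmooth_pushforward (Quot.mk (GlueRel f))) dSmooth_inl

theorem dSmooth_i₂ : DSmooth (i₂ f) :=
  DSmooth.comp (Z := Glue f) (dSmooth_pushforward (Quot.mk (GlueRel f))) dSmooth_inr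

theorem dSmooth_glueMap {C : Type*} [DiffeologicalSpace C] {h₁ : X₁ → C} {h₂ : X₂ → C}
    (s₁ : DSmooth h₁) (s₂ : DSmooth h₂) (hc : ∀ y : Y, h₁ y = h₂ (f y)) :
    DSmooth (glueMap f h₁ h₂ hc) :=
  dSmooth_of_pushforward _ _ (dSmooth_sumElim s₁ s₂)

/-! ### The characteristic maps, compatibility, and the extendibility condition -/

/-- The restriction of `ρ̃₁^Λ`, induced by `ĩ₁^*`, to the fibre over `x = ĩ₁(x₁)`. -/
def rho₁ (x₁ : X₁) (x : Glue f) (hx : i₁ f x₁ = x) :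
    LambdaFibre (Glue f) x →ₗ[ℝ] LambdaFibre X₁ x₁ :=
  fibrePullback (i₁ f) (dSmooth_i₁ f) x₁ x hx

/-- The restriction of `ρ̃₂^Λ`, induced by `i₂^*`, to the fibre over `x = i₂(x₂)`. -/
def rho₂ (x₂ : X₂) (x : Glue f) (hx : i₂ f x₂ = x) :
    LambdaFibre (Glue f) x →ₗ[ℝ] LambdaFibre X₂ x₂ :=
  fibrePullback (i₂ f) (dSmooth_i₂ f) x₂ x hx

/-- Pairs of compatible forms: `ω₁(p) = ω₂(f ∘ p)` for every plot `p` of `X₁` with values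
in `Y`. -/
def compatibleForms (hf : DSmooth f) : Submodule ℝ (Omega X₁ × Omega X₂) where
  carrier := {η | ∀ (n : ℕ) (p : E n → Y) (hp : IsPlot p),
    η.1.1 n ⟨Subtype.val ∘ p, dSmooth_val Y n p hp⟩ = η.2.1 n ⟨f ∘ p, hf n p hp⟩}
  zero_mem' := fun _ _ _ => rfl
  add_mem' ha hb n p hp := congrArg₂ (· + ·) (ha n p hp) (hb n p hp)
  smul_mem' c _ ha n p hp := congrArg (c • ·) (ha n p hp)

/-- The space `Λ¹_y(X₁) ⊕_comp Λ¹_{f(y)}(X₂)`: the pairs of classes that are represented by a pair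
of compatible forms. -/
def compSum (hf : DSmooth f) (y : Y) :
    Submodule ℝ (LambdaFibre X₁ (y : X₁) × LambdaFibre X₂ (f y)) :=
  (compatibleForms f hf).map
    ((vanishing (y : X₁)).mkQ.prodMap (vanishing (f y)).mkQ)

/-- The restriction of `ρ̃₁^Λ ⊕ ρ̃₂^Λ` to the fibre over `x = i₂(f(y)) = ĩ₁(y)`, with values in
`Λ¹_y(X₁) ⊕_comp Λ¹_{f(y)}(X₂)`. -/
def rhoSum (hf : DSmooth f) (y : Y) (x : Glue f) (hx : i₂ f (f y) = x) :
    LambdaFibre (Glue f) x →ₗ[ℝ] compSum f hf y :=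
  LinearMap.codRestrict _
    ((rho₁ f y x ((i₁_eq_i₂ f y).trans hx)).prod (rho₂ f (f y) x hx)) <| by
      intro α
      obtain ⟨η, rfl⟩ := Submodule.mkQ_surjective _ α
      refine ⟨(pullback (i₁ f) (dSmooth_i₁ f) η, pullback (i₂ f) (dSmooth_i₂ f) η), ?_, rfl⟩
      intro n p hp
      have h : i₁ f ∘ Subtype.val ∘ p = i₂ f ∘ f ∘ p := funext fun u => i₁_eq_i₂ f (p u)
      exact congrArg (η.1 n) (Subtype.ext h)

variable {f}

/-- `f` is a diffeomorphism of its domain `Y` onto its image `f(Y)`, both with the subset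
diffeology. -/
def IsDiffeoOntoImage (f : Y → X₂) : Prop :=
  IsDiffeomorphism (Set.rangeFactorization f)

theorem IsDiffeoOntoImage.dSmooth (hf : IsDiffeoOntoImage f) : DSmooth f :=
  DSmooth.comp (g := (Subtype.val : Set.range f → X₂)) (dSmooth_val (Set.range f)) hf.1

/-- The diffeology `D₁^Ω` on `Ω¹(Y)`: the pushforward of that of `Ω¹(X₁)` by `i^*`, where
`i : Y → X₁` is the inclusion. -/
@[reducible]
def dOmega₁ (Y : Set X₁) : DiffeologicalSpace (Omega Y) :=
  pushforward (pullback (Subtype.val : Y → X₁) (dSmooth_val Y))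

/-- The diffeology `D₂^Ω` on `Ω¹(Y)`: the pushforward of that of `Ω¹(X₂)` by `f^* j^*`, where
`j : f(Y) → X₂` is the inclusion. -/
@[reducible]
def dOmega₂ (hf : IsDiffeoOntoImage f) : DiffeologicalSpace (Omega Y) :=
  pushforward fun η : Omega X₂ =>
    pullback (Set.rangeFactorization f) hf.1
      (pullback (Subtype.val : Set.range f → X₂) (dSmooth_val (Set.range f)) η)

end Gluing

end DiffGlue

end

open Topology

namespace DiffGlue

/-! ### Localization -/

/-! Since $\tilde i_1^*\,dh=dh_1$ and $i_2^*\,dh=dh_2$, the formulas for $dh(x)$ follow once the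
maps on fibres are known to be bijective. Injectivity: a plot of $X$ lifts near each point to $X_1$
or $X_2$ (`exists_lift_of_isPlot_glue`), and the value of a form at a point depends only on the germ
of the plot (`Omega.apply_congr`). So a form vanishes at $x$ as soon as its pullbacks vanish at the
preimages of $x$ (`mem_vanishing_glue`). Surjectivity: a compatible pair glues to a form on $X$ by
evaluation on local lifts (`exists_glueForm`). Over $i_2(f(Y))$ the target consists of classes of
such pairs. Elsewhere a form on one factor needs a compatible partner on the other, which $\mathcal
D_1^\Omega=\mathcal D_2^\Omega$ supplies (`exists_apply_eq_of_pushforward_eq`): it forces $i^*$ and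
$f^*j^*$ to have the same range. -/

/-- Every neighbourhood of `u` contains the image of a smooth map which is the identity near `u`. -/
theorem exists_contDiff_eventuallyEq_id {n : ℕ} {u : E n} {s : Set (E n)} (hs : s ∈ 𝓝 u) :
    ∃ F : E n → E n, ContDiff ℝ ∞ F ∧ (∀ v, F v ∈ s) ∧ F =ᶠ[𝓝 u] id := by
  obtain ⟨ε, hε, hball⟩ := Metric.mem_nhds_iff.1 hs
  let φ : ContDiffBump u := ⟨ε / 2, ε, half_pos hε, half_lt_self hε⟩
  -- The bump is 1 near `u`, which gives the identity there; outside the ball it is 0, which sends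
  -- `v` to `u`.
  refine ⟨fun v => u + φ v • (v - u), ?_, fun v => hball ?_, ?_⟩
  · exact contDiff_const.add (φ.contDiff.smul (contDiff_id.sub contDiff_const))
  · rw [Metric.mem_ball, dist_eq_norm, add_sub_cancel_left, norm_smul, Real.norm_eq_abs,
      abs_of_nonneg φ.nonneg]
    by_cases hv : ε ≤ dist v u
    · rw [φ.zero_of_le_dist hv, zero_mul]
      exact hε
    · rw [← dist_eq_norm]
      exact (mul_le_of_le_one_left dist_nonneg φ.le_one).trans_lt (not_le.1 hv)
  · filter_upwards [φ.eventuallyEq_one] with v hv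
    simp [hv]

/-- The diffeology of the maps that agree locally with members of a family `G` of maps that contains
the constants and is stable under smooth changes of parameter. -/
@[reducible]
def localDiffeology {B : Type*} (G : ∀ n, Set (E n → B)) (hG : ∀ n (b : B), (fun _ => b) ∈ G n)
    (hr : ∀ {m n : ℕ} {p : E n → B} {F : E m → E n}, p ∈ G n → ContDiff ℝ ∞ F → p ∘ F ∈ G m) :
    DiffeologicalSpace B where
  plots n := {p | ∀ u, ∃ q ∈ G n, p =ᶠ[𝓝 u] q}
  constant_plots b _ := ⟨_, hG _ b, Filter.EventuallyEq.rfl⟩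
  plot_reparam {n m p F} hp hF u := by
    obtain ⟨q, hq, h⟩ := hp (F u)
    exact ⟨q ∘ F, hr hq hF, h.comp_tendsto hF.continuous.continuousAt⟩
  locality {n p} h u := by
    obtain ⟨s, hs, hu, h'⟩ := h u
    -- Plots are defined on all of `E n`, so restriction to `s` is replaced by composition with a
    -- global map into `s`.
    obtain ⟨F, hF, hFs, hid⟩ := exists_contDiff_eventuallyEq_id (hs.mem_nhds hu)
    obtain ⟨q, hq, hpq⟩ := h' hFs hF u
    refine ⟨q, hq, Filter.EventuallyEq.trans ?_ hpq⟩
    filter_upwards [hid] with v hv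
    simp [hv]

/-- A plot of a pushforward diffeology is locally constant or lifts locally to a plot. -/
theorem exists_lift_of_isPlot_pushforward {A B : Type*} [DiffeologicalSpace A] (g : A → B) {n : ℕ}
    {p : E n → B} (hp : @IsPlot B (pushforward g) n p) (u : E n) :
    (∃ b : B, p =ᶠ[𝓝 u] fun _ => b) ∨ ∃ q : E n → A, IsPlot q ∧ p =ᶠ[𝓝 u] g ∘ q := by
  -- The pushforward is the smallest diffeology making `g` smooth, so its plots are plots of this
  -- one. Constants must be allowed because `g` need not be surjective.
  let d : DiffeologicalSpace B := localDiffeology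
    (fun n => {p | (∃ b : B, p = fun _ => b) ∨ ∃ q : E n → A, IsPlot q ∧ p = g ∘ q})
    (fun _ b => Or.inl ⟨b, rfl⟩) (by
      rintro m n _ F (⟨b, rfl⟩ | ⟨q, hq, rfl⟩) hF
      · exact Or.inl ⟨b, rfl⟩
      · exact Or.inr ⟨q ∘ F, isPlot_reparam hq hF, rfl⟩)
  obtain ⟨_, ⟨b, rfl⟩ | ⟨q, hq, rfl⟩, h⟩ := DiffeologicalSpace.isPlot_sInf_iff.1 hp d
    (fun m q hq v => ⟨g ∘ q, Or.inr ⟨q, hq, rfl⟩, Filter.EventuallyEq.rfl⟩) u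
  · exact Or.inl ⟨b, h⟩
  · exact Or.inr ⟨q, hq, h⟩

/-- The value of a form on a plot at a point depends only on the germ of the plot. -/
theorem Omega.apply_congr {X : Type*} [DiffeologicalSpace X] (θ : Omega X) {n : ℕ}
    {p q : E n → X} (hp : IsPlot p) (hq : IsPlot q) {u : E n} (h : p =ᶠ[𝓝 u] q) :
    θ.1 n ⟨p, hp⟩ u = θ.1 n ⟨q, hq⟩ u := by
  obtain ⟨F, hF, hFs, hid⟩ := exists_contDiff_eventuallyEq_id h
  -- As `F` is the identity near `u`, its derivative there is the identity and reparametrization by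
  -- `F` keeps the value at `u`; but `p ∘ F = q ∘ F` everywhere.
  have key : ∀ (r : E n → X) (hr : IsPlot r),
      θ.1 n ⟨r ∘ F, isPlot_reparam hr hF⟩ u = θ.1 n ⟨r, hr⟩ u := fun r hr => by
    rw [(mem_Omega.1 θ.2).2 n n ⟨r, hr⟩ F hF u, hid.eq_of_nhds, hid.fderiv_eq, fderiv_id]
    exact ContinuousLinearMap.comp_id _
  rw [← key p hp, ← key q hq]
  exact congrArg (fun r => θ.1 n r u) (Subtype.ext (funext hFs))

section Gluing

variable {X₁ X₂ : Type*} {Y : Set X₁} {f : Y → X₂} [DiffeologicalSpace X₁] [DiffeologicalSpace X₂]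

/-- The plots of the glued space lift locally to one of the two factors. -/
theorem exists_lift_of_isPlot_glue {n : ℕ} {p : E n → Glue f} (hp : IsPlot p) (u : E n) :
    (∃ q : E n → X₁, IsPlot q ∧ p =ᶠ[𝓝 u] i₁ f ∘ q) ∨
      ∃ q : E n → X₂, IsPlot q ∧ p =ᶠ[𝓝 u] i₂ f ∘ q := by
  let d : DiffeologicalSpace (Glue f) := localDiffeology
    (fun n => {p | (∃ q : E n → X₁, IsPlot q ∧ p = i₁ f ∘ q) ∨
      ∃ q : E n → X₂, IsPlot q ∧ p = i₂ f ∘ q})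
    (fun n b => by
      obtain ⟨a | a, rfl⟩ := Quot.exists_rep b
      · exact Or.inl ⟨fun _ => a, isPlot_const, rfl⟩
      · exact Or.inr ⟨fun _ => a, isPlot_const, rfl⟩) (by
      rintro m n _ F (⟨q, hq, rfl⟩ | ⟨q, hq, rfl⟩) hF
      · exact Or.inl ⟨q ∘ F, isPlot_reparam hq hF, rfl⟩
      · exact Or.inr ⟨q ∘ F, isPlot_reparam hq hF, rfl⟩)
  have h₁ : @DSmooth X₁ (Glue f) _ d (i₁ f) := fun m q hq v =>
    ⟨i₁ f ∘ q, Or.inl ⟨q, hq, rfl⟩, Filter.EventuallyEq.rfl⟩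
  have h₂ : @DSmooth X₂ (Glue f) _ d (i₂ f) := fun m q hq v =>
    ⟨i₂ f ∘ q, Or.inr ⟨q, hq, rfl⟩, Filter.EventuallyEq.rfl⟩
  have hmk : @DSmooth (X₁ ⊕ X₂) (Glue f) _ d (Quot.mk (GlueRel f)) := by
    have h := @dSmooth_sumElim X₁ X₂ (Glue f) _ _ d _ _ h₁ h₂
    rwa [show Sum.elim (i₁ f) (i₂ f) = Quot.mk (GlueRel f) from
      funext fun z => by cases z <;> rfl] at h
  obtain ⟨_, ⟨q, hq, rfl⟩ | ⟨q, hq, rfl⟩, h⟩ :=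
    DiffeologicalSpace.isPlot_sInf_iff.1 hp d hmk u
  · exact Or.inl ⟨q, hq, h⟩
  · exact Or.inr ⟨q, hq, h⟩

theorem IsDiffeoOntoImage.injective (hf : IsDiffeoOntoImage f) : Function.Injective f := by
  obtain ⟨-, k, -, hk, -⟩ := hf
  exact fun a b h => hk.injective (Subtype.ext h)

/-! ### Gluing of compatible forms -/

/-- `L` is a value at `u` of the glued form `ω₁ ∪_f ω₂` on the map `p`, computed on a local lift
of `p`. -/
def IsGlueValue (ω₁ : Omega X₁) (ω₂ : Omega X₂) {n : ℕ} (p : E n → Glue f) (u : E n)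
    (L : E n →L[ℝ] ℝ) : Prop :=
  (∃ (q : E n → X₁) (hq : IsPlot q), p =ᶠ[𝓝 u] i₁ f ∘ q ∧ L = ω₁.1 n ⟨q, hq⟩ u) ∨
    ∃ (q : E n → X₂) (hq : IsPlot q), p =ᶠ[𝓝 u] i₂ f ∘ q ∧ L = ω₂.1 n ⟨q, hq⟩ u

theorem exists_isGlueValue (ω₁ : Omega X₁) (ω₂ : Omega X₂) {n : ℕ} {p : E n → Glue f}
    (hp : IsPlot p) (u : E n) : ∃ L, IsGlueValue ω₁ ω₂ p u L := by
  obtain ⟨q, hq, h⟩ | ⟨q, hq, h⟩ := exists_lift_of_isPlot_glue hp u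
  · exact ⟨_, Or.inl ⟨q, hq, h, rfl⟩⟩
  · exact ⟨_, Or.inr ⟨q, hq, h, rfl⟩⟩

/-- Compatible forms agree on local lifts of the same map to the two factors. -/
theorem apply_eq_of_compatible (hf : DSmooth f) {ω₁ : Omega X₁} {ω₂ : Omega X₂}
    (hω : (ω₁, ω₂) ∈ compatibleForms f hf) {n : ℕ} {q₁ : E n → X₁} {q₂ : E n → X₂}
    (hq₁ : IsPlot q₁) (hq₂ : IsPlot q₂) {u : E n} (h : i₁ f ∘ q₁ =ᶠ[𝓝 u] i₂ f ∘ q₂) :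
    ω₁.1 n ⟨q₁, hq₁⟩ u = ω₂.1 n ⟨q₂, hq₂⟩ u := by
  obtain ⟨F, hF, hFs, hid⟩ := exists_contDiff_eventuallyEq_id h
  -- After composition with `F` the two lifts agree in the glued space everywhere, which is possible
  -- only over `Y`.
  have hY : ∀ v, q₁ (F v) ∈ Y := fun v => by
    by_contra hv
    exact i₁_ne_i₂ f hv _ (hFs v)
  let r : E n → Y := fun v => ⟨q₁ (F v), hY v⟩
  have hr : IsPlot r := isPlot_reparam hq₁ hF
  have hfr : ∀ v, f (r v) = q₂ (F v) := fun v =>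
    i₂_injective f ((i₁_eq_i₂ f (r v)).symm.trans (hFs v))
  have e₁ : q₁ =ᶠ[𝓝 u] Subtype.val ∘ r := by
    filter_upwards [hid] with v hv
    simp [r, hv]
  have e₂ : f ∘ r =ᶠ[𝓝 u] q₂ := by
    filter_upwards [hid] with v hv
    simp [hfr, hv]
  rw [Omega.apply_congr ω₁ hq₁ (dSmooth_val Y n r hr) e₁, ← Omega.apply_congr ω₂ (hf n r hr) hq₂ e₂]
  exact congrFun (hω n r hr) u

/-- Two lifts to the same factor have the same germ, as `i₁ f` and `i₂ f` are injective; lifts to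
different factors are compared by compatibility. -/
theorem IsGlueValue.unique (hf : DSmooth f) (hinj : Function.Injective f) {ω₁ : Omega X₁}
    {ω₂ : Omega X₂} (hω : (ω₁, ω₂) ∈ compatibleForms f hf) {n : ℕ} {p : E n → Glue f} {u : E n}
    {L L' : E n →L[ℝ] ℝ} (h : IsGlueValue ω₁ ω₂ p u L) (h' : IsGlueValue ω₁ ω₂ p u L') :
    L = L' := by
  obtain ⟨q, hq, hpq, rfl⟩ | ⟨q, hq, hpq, rfl⟩ := h <;>
    obtain ⟨q', hq', hpq', rfl⟩ | ⟨q', hq', hpq', rfl⟩ := h'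
  · exact Omega.apply_congr ω₁ hq hq' ((hpq.symm.trans hpq').mono fun v hv => i₁_injective f hinj hv)
  · exact apply_eq_of_compatible hf hω hq hq' (hpq.symm.trans hpq')
  · exact (apply_eq_of_compatible hf hω hq' hq (hpq'.symm.trans hpq)).symm
  · exact Omega.apply_congr ω₂ hq hq' ((hpq.symm.trans hpq').mono fun v hv => i₂_injective f hv)

/-- Compatible forms on the factors glue to a form on the glued space. -/
theorem exists_glueForm (hf : DSmooth f) (hinj : Function.Injective f) {ω₁ : Omega X₁}
    {ω₂ : Omega X₂} (hω : (ω₁, ω₂) ∈ compatibleForms f hf) :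
    ∃ η : Omega (Glue f), pullback (i₁ f) (dSmooth_i₁ f) η = ω₁ ∧
      pullback (i₂ f) (dSmooth_i₂ f) η = ω₂ := by
  choose η hη using fun (n : ℕ) (p : {p : E n → Glue f // IsPlot p}) (u : E n) =>
    exists_isGlueValue ω₁ ω₂ p.2 u
  have eq_of {n : ℕ} (p : {p : E n → Glue f // IsPlot p}) (u : E n) {L : E n →L[ℝ] ℝ}
      (hL : IsGlueValue ω₁ ω₂ p.1 u L) : η n p u = L := (hη n p u).unique hf hinj hω hL
  refine ⟨⟨η, mem_Omega.2 ⟨fun n p => contDiff_iff_contDiffAt.2 fun u => ?_,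
    fun m n p F hF u => ?_⟩⟩, ?_, ?_⟩
  -- One lift serves all points near `u`, so near `u` the glued form is a smooth form of a factor
  -- evaluated on that lift.
  · obtain ⟨q, hq, h⟩ | ⟨q, hq, h⟩ := exists_lift_of_isPlot_glue p.2 u
    · exact ((mem_Omega.1 ω₁.2).1 n ⟨q, hq⟩).contDiffAt.congr_of_eventuallyEq
        (h.eventuallyEq_nhds.mono fun v hv => eq_of p v (Or.inl ⟨q, hq, hv, rfl⟩))
    · exact ((mem_Omega.1 ω₂.2).1 n ⟨q, hq⟩).contDiffAt.congr_of_eventuallyEq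
        (h.eventuallyEq_nhds.mono fun v hv => eq_of p v (Or.inr ⟨q, hq, hv, rfl⟩))
  · refine eq_of _ u ?_
    obtain ⟨q, hq, h, hL⟩ | ⟨q, hq, h, hL⟩ := hη n p (F u)
    · refine Or.inl ⟨q ∘ F, isPlot_reparam hq hF,
        h.comp_tendsto hF.continuous.continuousAt, ?_⟩
      rw [hL]
      exact ((mem_Omega.1 ω₁.2).2 m n ⟨q, hq⟩ F hF u).symm
    · refine Or.inr ⟨q ∘ F, isPlot_reparam hq hF,
        h.comp_tendsto hF.continuous.continuousAt, ?_⟩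
      rw [hL]
      exact ((mem_Omega.1 ω₂.2).2 m n ⟨q, hq⟩ F hF u).symm
  · refine Subtype.ext (funext fun n => funext fun p => funext fun u => ?_)
    exact eq_of _ u (Or.inl ⟨p.1, p.2, Filter.EventuallyEq.rfl, rfl⟩)
  · refine Subtype.ext (funext fun n => funext fun p => funext fun u => ?_)
    exact eq_of _ u (Or.inr ⟨p.1, p.2, Filter.EventuallyEq.rfl, rfl⟩)

/-! ### Extendibility of forms -/

/-- If a linear map `g` and a map `g'` into `Ω¹(Z)` with `g' 0 = 0` push forward the functional
diffeologies to the same diffeology, the range of `g` lies in the range of `g'`. -/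
theorem exists_apply_eq_of_pushforward_eq {A B Z : Type*} [DiffeologicalSpace A] [DiffeologicalSpace B]
    [DiffeologicalSpace Z] {g : Omega A →ₗ[ℝ] Omega Z} {g' : Omega B → Omega Z}
    (h : pushforward g = pushforward g') (h0 : g' 0 = 0) (θ : Omega A) :
    ∃ θ' : Omega B, g' θ' = g θ := by
  -- The line `t • θ` is a plot, and its image under `g` is a plot for the pushforward by `g'`; a
  -- lift at `t = 1` gives the preimage.
  have hplot : IsPlot fun t : E 1 => t 0 • θ := fun n p => by
    change ContDiff ℝ ∞ fun z : E 1 × E n => z.1 0 • θ.1 n p z.2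
    have ht : ContDiff ℝ ∞ fun z : E 1 × E n => z.1 0 := by fun_prop
    exact ht.smul (((mem_Omega.1 θ.2).1 n p).comp contDiff_snd)
  have hplot' := dSmooth_pushforward (g : Omega A → Omega Z) 1 _ hplot
  rw [h] at hplot'
  let e : E 1 := EuclideanSpace.single 0 1
  obtain ⟨b, hb⟩ | ⟨q, -, hq⟩ := exists_lift_of_isPlot_pushforward g' hplot' e
  -- If instead `t • g θ` is constant near `t = 1`, comparison with some `s ≠ 1` gives `g θ = 0`,
  -- and `0` is a preimage.
  · have hlim : Filter.Tendsto (fun s : ℝ => s • e) (𝓝 1) (𝓝 e) := by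
      have : Continuous fun s : ℝ => s • e := by fun_prop
      simpa using this.tendsto 1
    have hs : ∀ᶠ s : ℝ in 𝓝 1, s • g θ = b := by
      filter_upwards [hlim.eventually hb] with s hs
      simpa [e] using hs
    obtain ⟨s, hs, hs1⟩ := ((hs.filter_mono nhdsWithin_le_nhds).and
      (self_mem_nhdsWithin : {(1 : ℝ)}ᶜ ∈ 𝓝[≠] 1)).exists
    have h1 : (1 : ℝ) • g θ = b := by simpa [e] using hb.eq_of_nhds
    have hz : (s - 1) • g θ = 0 := by rw [sub_smul, hs, h1, sub_self]
    exact ⟨0, h0.trans ((smul_eq_zero.1 hz).resolve_left (sub_ne_zero.2 hs1)).symm⟩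
  · exact ⟨q e, by simpa [e] using hq.eq_of_nhds.symm⟩

/-- Compatibility says exactly that the two forms have the same pullback to `Y`, so equality of
ranges provides the partner. -/
theorem exists_compatible_left (hf : IsDiffeoOntoImage f) (hD : dOmega₁ Y = dOmega₂ hf)
    (ω₁ : Omega X₁) : ∃ ω₂ : Omega X₂, (ω₁, ω₂) ∈ compatibleForms f hf.dSmooth := by
  obtain ⟨ω₂, h⟩ := exists_apply_eq_of_pushforward_eq hD (map_zero
    ((pullback (Set.rangeFactorization f) hf.1).comp
      (pullback (Subtype.val : Set.range f → X₂) (dSmooth_val (Set.range f))))) ω₁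
  exact ⟨ω₂, fun n p hp => (congrArg (fun θ : Omega Y => θ.1 n ⟨p, hp⟩) h).symm⟩

theorem exists_compatible_right (hf : IsDiffeoOntoImage f) (hD : dOmega₁ Y = dOmega₂ hf)
    (ω₂ : Omega X₂) : ∃ ω₁ : Omega X₁, (ω₁, ω₂) ∈ compatibleForms f hf.dSmooth := by
  obtain ⟨ω₁, h⟩ := exists_apply_eq_of_pushforward_eq
    (g := (pullback (Set.rangeFactorization f) hf.1).comp
      (pullback (Subtype.val : Set.range f → X₂) (dSmooth_val (Set.range f)))) hD.symm
    (map_zero (pullback (Subtype.val : Y → X₁) (dSmooth_val Y))) ω₂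
  exact ⟨ω₁, fun n p hp => congrArg (fun θ : Omega Y => θ.1 n ⟨p, hp⟩) h⟩

/-! ### The characteristic maps are bijective -/

/-- A form on the glued space vanishes at `x` if its pullbacks vanish at all preimages of `x`. -/
theorem mem_vanishing_glue {x : Glue f} {η : Omega (Glue f)}
    (h₁ : ∀ x₁, i₁ f x₁ = x → pullback (i₁ f) (dSmooth_i₁ f) η ∈ vanishing x₁)
    (h₂ : ∀ x₂, i₂ f x₂ = x → pullback (i₂ f) (dSmooth_i₂ f) η ∈ vanishing x₂) :
    η ∈ vanishing x := by
  rintro n ⟨p, hp⟩ hpx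
  obtain ⟨q, hq, h⟩ | ⟨q, hq, h⟩ := exists_lift_of_isPlot_glue hp 0
  · rw [Omega.apply_congr η hp (dSmooth_i₁ f n q hq) h]
    exact h₁ (q 0) (h.eq_of_nhds.symm.trans hpx) n ⟨q, hq⟩ rfl
  · rw [Omega.apply_congr η hp (dSmooth_i₂ f n q hq) h]
    exact h₂ (q 0) (h.eq_of_nhds.symm.trans hpx) n ⟨q, hq⟩ rfl

theorem rho₁_mkQ (x₁ : X₁) (x : Glue f) (hx : i₁ f x₁ = x) (η : Omega (Glue f)) :
    rho₁ f x₁ x hx ((vanishing x).mkQ η) =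
      (vanishing x₁).mkQ (pullback (i₁ f) (dSmooth_i₁ f) η) := rfl

theorem rho₂_mkQ (x₂ : X₂) (x : Glue f) (hx : i₂ f x₂ = x) (η : Omega (Glue f)) :
    rho₂ f x₂ x hx ((vanishing x).mkQ η) =
      (vanishing x₂).mkQ (pullback (i₂ f) (dSmooth_i₂ f) η) := rfl

theorem mem_vanishing_of_mkQ_eq_zero {X : Type*} [DiffeologicalSpace X] {x : X} {θ : Omega X}
    (h : (vanishing x).mkQ θ = 0) : θ ∈ vanishing x :=
  (Submodule.Quotient.mk_eq_zero _).1 h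

/-- Off `Y` the point `x` has `x₁` as its only preimage in either factor, so vanishing need only be
tested there. -/
theorem rho₁_bijective (hf : IsDiffeoOntoImage f) (hD : dOmega₁ Y = dOmega₂ hf) {x₁ : X₁}
    (hx₁ : x₁ ∉ Y) {x : Glue f} (hx : i₁ f x₁ = x) : Function.Bijective (rho₁ f x₁ x hx) := by
  refine ⟨(injective_iff_map_eq_zero _).2 fun α hα => ?_, fun β => ?_⟩
  · obtain ⟨η, rfl⟩ := Submodule.mkQ_surjective _ α
    rw [rho₁_mkQ] at hα
    refine (Submodule.Quotient.mk_eq_zero _).2 (mem_vanishing_glue (fun z hz => ?_)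
      fun z hz => absurd (hx.trans hz.symm) (i₁_ne_i₂ f hx₁ z))
    obtain rfl := i₁_injective f hf.injective (hz.trans hx.symm)
    exact mem_vanishing_of_mkQ_eq_zero hα
  · obtain ⟨ω₁, rfl⟩ := Submodule.mkQ_surjective _ β
    obtain ⟨ω₂, hω⟩ := exists_compatible_left hf hD ω₁
    obtain ⟨η, rfl, -⟩ := exists_glueForm hf.dSmooth hf.injective hω
    exact ⟨(vanishing x).mkQ η, rfl⟩

theorem rho₂_bijective (hf : IsDiffeoOntoImage f) (hD : dOmega₁ Y = dOmega₂ hf) {x₂ : X₂}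
    (hx₂ : x₂ ∉ Set.range f) {x : Glue f} (hx : i₂ f x₂ = x) :
    Function.Bijective (rho₂ f x₂ x hx) := by
  refine ⟨(injective_iff_map_eq_zero _).2 fun α hα => ?_, fun β => ?_⟩
  · obtain ⟨η, rfl⟩ := Submodule.mkQ_surjective _ α
    rw [rho₂_mkQ] at hα
    refine (Submodule.Quotient.mk_eq_zero _).2 (mem_vanishing_glue (fun z hz => ?_)
      fun z hz => ?_)
    · have hzY : z ∈ Y := by
        by_contra hzY
        exact i₁_ne_i₂ f hzY x₂ (hz.trans hx.symm)
      exact absurd ⟨⟨z, hzY⟩, i₂_injective f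
        ((i₁_eq_i₂ f ⟨z, hzY⟩).symm.trans (hz.trans hx.symm))⟩ hx₂
    · obtain rfl := i₂_injective f (hz.trans hx.symm)
      exact mem_vanishing_of_mkQ_eq_zero hα
  · obtain ⟨ω₂, rfl⟩ := Submodule.mkQ_surjective _ β
    obtain ⟨ω₁, hω⟩ := exists_compatible_right hf hD ω₂
    obtain ⟨η, -, rfl⟩ := exists_glueForm hf.dSmooth hf.injective hω
    exact ⟨(vanishing x).mkQ η, rfl⟩

theorem rhoSum_bijective (hf : DSmooth f) (hinj : Function.Injective f) (y : Y) {x : Glue f}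
    (hx : i₂ f (f y) = x) : Function.Bijective (rhoSum f hf y x hx) := by
  refine ⟨(injective_iff_map_eq_zero _).2 fun α hα => ?_, ?_⟩
  · obtain ⟨η, rfl⟩ := Submodule.mkQ_surjective _ α
    have hα' := congrArg Subtype.val hα
    refine (Submodule.Quotient.mk_eq_zero _).2 (mem_vanishing_glue (fun z hz => ?_)
      fun z hz => ?_)
    · obtain rfl : z = y := i₁_injective f hinj (hz.trans (hx.symm.trans (i₁_eq_i₂ f y).symm))
      exact mem_vanishing_of_mkQ_eq_zero (congrArg Prod.fst hα')
    · obtain rfl := i₂_injective f (hz.trans hx.symm)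
      exact mem_vanishing_of_mkQ_eq_zero (congrArg Prod.snd hα')
  · rintro ⟨_, ⟨ω₁, ω₂⟩, hω, rfl⟩
    obtain ⟨η, rfl, rfl⟩ := exists_glueForm hf hinj hω
    exact ⟨(vanishing x).mkQ η, rfl⟩

end Gluing

end DiffGlue

theorem mainTheorem10 {X₁ X₂ : Type*} [DiffeologicalSpace X₁] [DiffeologicalSpace X₂]
    (Y : Set X₁) (f : Y → X₂) (hf : DiffGlue.IsDiffeoOntoImage f)
    (hD : DiffGlue.dOmega₁ Y = DiffGlue.dOmega₂ hf)
    (h₁ : X₁ → ℝ) (h₂ : X₂ → ℝ) (s₁ : DSmooth h₁) (s₂ : DSmooth h₂)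
    (hc : ∀ y : Y, h₁ y = h₂ (f y)) (x : DiffGlue.Glue f) :
    (∀ (x₁ : X₁) (_ : x₁ ∉ Y) (hx : DiffGlue.i₁ f x₁ = x),
      ∃ hb : Function.Bijective (DiffGlue.rho₁ f x₁ x hx),
        DiffGlue.dSection (DiffGlue.glueMap f h₁ h₂ hc) (DiffGlue.dSmooth_glueMap f s₁ s₂ hc) x =
          (LinearEquiv.ofBijective (DiffGlue.rho₁ f x₁ x hx) hb).symm
            (DiffGlue.dSection h₁ s₁ x₁)) ∧
    (∀ (y : Y) (hx : DiffGlue.i₂ f (f y) = x),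
      ∃ (hb : Function.Bijective (DiffGlue.rhoSum f hf.dSmooth y x hx))
        (hm : (DiffGlue.dSection h₁ s₁ (y : X₁), DiffGlue.dSection h₂ s₂ (f y)) ∈
          DiffGlue.compSum f hf.dSmooth y),
        DiffGlue.dSection (DiffGlue.glueMap f h₁ h₂ hc) (DiffGlue.dSmooth_glueMap f s₁ s₂ hc) x =
          (LinearEquiv.ofBijective (DiffGlue.rhoSum f hf.dSmooth y x hx) hb).symm
            ⟨(DiffGlue.dSection h₁ s₁ (y : X₁), DiffGlue.dSection h₂ s₂ (f y)), hm⟩) ∧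
    (∀ (x₂ : X₂) (_ : x₂ ∉ Set.range f) (hx : DiffGlue.i₂ f x₂ = x),
      ∃ hb : Function.Bijective (DiffGlue.rho₂ f x₂ x hx),
        DiffGlue.dSection (DiffGlue.glueMap f h₁ h₂ hc) (DiffGlue.dSmooth_glueMap f s₁ s₂ hc) x =
          (LinearEquiv.ofBijective (DiffGlue.rho₂ f x₂ x hx) hb).symm
            (DiffGlue.dSection h₂ s₂ x₂)) := by
  refine ⟨fun x₁ hx₁ hx => ⟨DiffGlue.rho₁_bijective hf hD hx₁ hx, ?_⟩,
    fun y hx => ⟨DiffGlue.rhoSum_bijective hf.dSmooth hf.injective y hx,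
      -- The pair of differentials is the image of `dh(x)`, hence lies in the codomain of `rhoSum`.
      (DiffGlue.rhoSum f hf.dSmooth y x hx (DiffGlue.dSection (DiffGlue.glueMap f h₁ h₂ hc)
        (DiffGlue.dSmooth_glueMap f s₁ s₂ hc) x)).2, ?_⟩,
    fun x₂ hx₂ hx => ⟨DiffGlue.rho₂_bijective hf hD hx₂ hx, ?_⟩⟩ <;>
  -- What remains is that the pullbacks of `dh` are `dh₁` and `dh₂`; this is definitional because
  -- `glueMap` is a `Quot.lift`.
  · rw [LinearEquiv.eq_symm_apply]
    rfl
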